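/- Let $p$ be an odd prime, $n$ a positive integer, $F$ a field of characteristic $0$ with algebraic closure $\overline{F}$, and $G$ a finite (metabelian) group with a cyclic subgroup $K$ of order $p^n$ that contains the derived subgroup $G'$ and is maximal among the abelian normal subgroups of $G$. Let $\rho$ be a faithful irreducible $\overline{F}$-representation of $G$ with character $\chi$, and let $\lambda$ be an irreducible $\overline{F}$-representation of $K$ that is a constituent of the restriction of $\rho$ to $K$. Write $F(\chi)$ and $F(\lambda)$ for the fields generated over $F$ by the values of the characters of $\rho$ and $\lambda$, and identify $\lambda$ with its character; for $g\in G$ put $\lambda^g(k)=\lambda(gkg^{-1})$ $(k\in K)$, and for $\tau\in\mathrm{Gal}(F(\lambda)/F)$ put $\lambda^\tau(k)=\tau(\lambda(k))$. Let $$I=\{g\in G : \lambda^g=\lambda^{\tau}\text{ for some }\tau\in \mathrm{Gal}(F(\lambda)/F)\}.$$ Then the following hold. (1) $\lambda$ is one-dimensional and faithful, $\rho$ is equivalent to the induced representation $\lambda\uparrow_K^G$, and $F(\lambda)=F(\zeta)$ for every primitive $p^n$-th root of unity $\zeta\in\overline{F}$. Moreover $I$ is a subgroup of $G$ containing $K$,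 $F(\chi)\subseteq F(\lambda)$, the extension $F(\lambda)/F(\chi)$ is Galois, $I/K\cong\mathrm{Gal}(F(\lambda)/F(\chi))$, and this group is cyclic. (2) Suppose that $I=G$ and that $G/K=\langle yK\rangle$ is of order $d$, where $y\in G$. Then there is an $F$-automorphism $\sigma$ of $F(\lambda)$ such that $\lambda^y=\lambda^\sigma$, and $F(\chi)$ is the subfield of $F(\lambda)$ fixed by $\sigma$. Moreover, there is exactly one primitive central idempotent $e$ of $F[G]$ that is not annihilated by $\rho$ (extended linearly to the group algebra), and the Wedderburn component $F[G]e$ of $F[G]$ corresponding to $\rho$ is isomorphic, as an $F$-algebra, to the matrix algebra $M_d(F(\chi))$. -/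

import Mathlib

section CharacterFields

variable (F : Type*) {E : Type*} [Field F] [Field E] [Algebra F E]

/-- The field `F(θ)` obtained from `F` by adjoining all the values of an `E`-valued function `θ`
on a group (used for the characters of representations over `E`). -/
def charField {H : Type*} (θ : H → E) : IntermediateField F E :=
  IntermediateField.adjoin F (Set.range θ)

/-- The value `θ h`, as an element of the field `F(θ)`. -/
def charVal {H : Type*} (θ : H → E) (h : H) : charField F θ :=
  ⟨θ h, IntermediateField.subset_adjoin F _ (Set.mem_range_self h)⟩

/-- For a normal subgroup `K` of `G`, a function `θ` on `K` (a character of `K`), `g : G` and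
`τ ∈ Gal(F(θ)/F)`: the relation `θ ^ g = θ ^ τ`, where `θ ^ g (k) = θ (g k g⁻¹)` and
`θ ^ τ (k) = τ (θ k)`. -/
def ConjEqGalois {G : Type*} [Group G] {K : Subgroup G} [K.Normal] (θ : K → E) (g : G)
    (τ : Gal(charField F θ/F)) : Prop :=
  ∀ k : K, charVal F θ (MulAut.conjNormal g k) = τ (charVal F θ k)

/-- The subgroup `{g ∈ G : there is τ ∈ Gal(F(θ)/F) with θ ^ g = θ ^ τ}` of `G`. -/
def galoisInertia {G : Type*} [Group G] {K : Subgroup G} [K.Normal] (θ : K → E) :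
    Subgroup G where
  carrier := {g | ∃ τ : Gal(charField F θ/F), ConjEqGalois F θ g τ}
  one_mem' := ⟨1, fun k => by simp⟩
  mul_mem' := by
    rintro a b ⟨σ, hσ⟩ ⟨τ, hτ⟩
    refine ⟨σ * τ, fun k => ?_⟩
    rw [map_mul, MulAut.mul_apply, hσ, hτ, AlgEquiv.mul_apply]
  inv_mem' := by
    rintro a ⟨σ, hσ⟩
    refine ⟨σ⁻¹, fun k => ?_⟩
    have h := hσ (MulAut.conjNormal a⁻¹ k)
    rw [← MulAut.mul_apply, ← map_mul, mul_inv_cancel, map_one, MulAut.one_apply] at h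
    rw [h, ← AlgEquiv.mul_apply, inv_mul_cancel, AlgEquiv.one_apply]

end CharacterFields

section Wedderburn

/-- For an idempotent `e` of an `F`-algebra `R`, the ring `e R e` (with identity `e`)
is an `F`-algebra. -/
noncomputable instance IsIdempotentElem.cornerAlgebra {F R : Type*} [Field F] [Ring R]
    [Algebra F R] {e : R} (he : IsIdempotentElem e) : Algebra F he.Corner where
  smul a x := ⟨a • x.1, by
    obtain ⟨r, hr⟩ := x.2
    exact ⟨a • r, by rw [← hr]; simp⟩⟩
  algebraMap :=
    { toFun := fun a => ⟨a • e, a • e, by simp [he.eq]⟩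
      map_one' := Subtype.ext (one_smul F e)
      map_mul' := fun a b => Subtype.ext (by
        change (a * b) • e = (a • e) * (b • e)
        rw [smul_mul_smul_comm, he.eq])
      map_zero' := Subtype.ext (zero_smul F e)
      map_add' := fun a b => Subtype.ext (add_smul a b e) }
  commutes' a x := Subtype.ext (by
    have hx := (Subsemigroup.mem_corner_iff he).mp x.2
    change (a • e) * x.1 = x.1 * (a • e)
    rw [smul_mul_assoc, mul_smul_comm, hx.1, hx.2])
  smul_def' a x := Subtype.ext (by
    have hx := (Subsemigroup.mem_corner_iff he).mp x.2
    change a • x.1 = (a • e) * x.1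
    rw [smul_mul_assoc, hx.1])

/-- `e` is a primitive central idempotent of the ring `R`: a nonzero central idempotent such that
the only central idempotents `f` with `e f = f` are `0` and `e`. -/
structure IsPrimitiveCentralIdempotent {R : Type*} [Ring R] (e : R) : Prop where
  idem : IsIdempotentElem e
  central : e ∈ Subring.center R
  ne_zero : e ≠ 0
  primitive : ∀ f ∈ Subring.center R, IsIdempotentElem f → e * f = f → f = 0 ∨ f = e

/-- `e` is the primitive central idempotent of the group algebra `F[G]` to which the irreducible
representation `ρ` of `G` over the extension field `E` of `F` belongs, i.e. the one that `ρ`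
(extended linearly to `E[G]`) does not annihilate. The Wedderburn component of `F[G]` corresponding
to `ρ` is then the algebra `F[G] e = e F[G] e`. -/
structure IsWedderburnIdempotent (F : Type*) {E G V : Type*} [Field F] [Field E] [Algebra F E]
    [Group G] [AddCommGroup V] [Module E V] (ρ : Representation E G V)
    (e : MonoidAlgebra F G) : Prop extends IsPrimitiveCentralIdempotent e where
  map_ne_zero : ρ.asAlgebraHom (MonoidAlgebra.mapRingHom G (algebraMap F E) e) ≠ 0

end Wedderburn

/-!
Since `K` is its own centralizer, distinct cosets of `K` conjugate the faithful character `l` of `K`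
to distinct characters. An eigenvector `w` of `K` in `ρ` with character `l` therefore has linearly
independent conjugates, one for each coset, and they form a basis by irreducibility
(`conjEigenvectorBasis`). This identifies `ρ` with the representation induced from `l`
(`nonempty_equiv_ind`) and shows that its character `χ` vanishes outside `K` and is, up to the factor
`|K|`, the sum of the conjugates of `l` on `K`.

The values of `l` generate a cyclotomic field `L = F(l)`. Sending `g` in the inertia group `I` to the
automorphism of `L` that has the same effect on `l` gives a homomorphism with kernel `K`, and by the
linear independence of characters its image consists of the automorphisms that fix `χ`
(`range_inertiaHom`). This gives the isomorphism of `I / K` with the Galois group over `F(χ)`; the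
group is cyclic because it embeds into the automorphism group of `K`.

Now let `I = G`. Since `p` is odd, `K` has a complement `H` in `G`
(`exists_isComplement'_of_isCyclic`): in terms of cohomology, the Tate group of `G / K` in degree zero
with values in `K` vanishes, by lifting the exponent. So `G = K ⋊ H` acts on `L`, with `K` acting
through multiplication by the values of `l` and `H` through Galois automorphisms. By Dedekind's
theorem `F[G]` maps onto the endomorphisms of `L` over `F(χ)` (`lift_action_surjective`), a matrix
algebra of degree `|G / K|`, and `L` embeds into `ρ` with spanning image, so that the kernel of this
map is the set of elements annihilated by `ρ` (`lift_action_eq_zero_iff`). Finally, a simple quotient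
of the semisimple ring `F[G]` is the corner of exactly one primitive central idempotent
(`exists_primitiveCentralIdempotent_corner`).
-/

/-! ### Splitting over a cyclic normal `p`-subgroup -/

/-- A normal subgroup containing the derived subgroup which is maximal among the abelian normal
subgroups contains its centralizer: adjoining a centralizing element to it gives an abelian
subgroup, which is normal since it contains the derived subgroup. -/
lemma mem_of_commute_of_maximal {G : Type*} [Group G] {K : Subgroup G}
    (hKmax : Maximal (fun H : Subgroup G => H.Normal ∧ IsMulCommutative H) K)
    (hGK : commutator G ≤ K) {g : G} (hg : ∀ k ∈ K, g * k = k * g) : g ∈ K := by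
  have hKc : ∀ a ∈ K, ∀ b ∈ K, a * b = b * a := fun a ha b hb => by
    have := hKmax.prop.2
    exact congrArg Subtype.val (mul_comm' (⟨a, ha⟩ : K) ⟨b, hb⟩)
  let H : Subgroup G := Subgroup.closure (insert g (K : Set G))
  have hKH : K ≤ H := fun k hk => Subgroup.subset_closure (Set.mem_insert_of_mem _ hk)
  have hH : H.Normal ∧ IsMulCommutative H := by
    refine ⟨Subgroup.Normal.of_commutator_le G (hGK.trans hKH), ?_⟩
    refine Subgroup.isMulCommutative_closure ?_
    rintro x (rfl | hx) z (rfl | hz)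
    · rfl
    · exact hg z hz
    · exact (hg x hx).symm
    · exact hKc x hx z hz
  exact hKmax.2 hH hKH (Subgroup.subset_closure (Set.mem_insert _ _))

/-- Conjugation acts on a cyclic normal subgroup by raising to a fixed power. -/
lemma exists_conjNormal_eq_zpow {G : Type*} [Group G] (K : Subgroup G) [K.Normal] [IsCyclic K]
    (g : G) : ∃ u : ℤ, ∀ k : K, MulAut.conjNormal g k = k ^ u :=
  MonoidHom.map_cyclic (MulAut.conjNormal g : MulAut K).toMonoidHom

/-- If the unit `u` has order `d` modulo the odd prime power `p ^ n`, then the norm element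
`1 + u + ⋯ + u ^ (d - 1)` maps `ℤ / p ^ n` onto the elements fixed by multiplication by `u`. For
`u ≢ 1` modulo `p` there are no nonzero fixed elements; for `u ≡ 1` lifting the exponent shows that
`d` is a power of `p` and that the norm element has the same `p`-adic valuation as `d`. -/
lemma exists_mul_geom_sum_add_dvd {p n : ℕ} (hp : p.Prime) (hp2 : p ≠ 2) {u : ℤ} {d : ℕ}
    (hd : ∀ j : ℕ, (p : ℤ) ^ n ∣ u ^ j - 1 ↔ d ∣ j) {m : ℤ} (hm : (p : ℤ) ^ n ∣ m * (u - 1)) :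
    ∃ t : ℤ, (p : ℤ) ^ n ∣ t * (∑ i ∈ Finset.range d, u ^ i) + m := by
  have hpZ : Prime (p : ℤ) := Nat.prime_iff_prime_int.mp hp
  by_cases h1 : (p : ℤ) ∣ u - 1
  swap
  · have hcop : IsCoprime ((p : ℤ) ^ n) (u - 1) :=
      ((Prime.coprime_iff_not_dvd hpZ).mpr h1).pow_left
    exact ⟨0, by simpa using hcop.dvd_of_dvd_mul_right hm⟩
  by_cases hu : u = 1
  · have hd1 : d = 1 := Nat.dvd_one.mp ((hd 1).mp (by simp [hu]))
    exact ⟨-m, by simp [hd1]⟩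
  have hodd : Odd p := hp.odd_of_ne_two hp2
  have hpu : ¬ (p : ℤ) ∣ u := fun h => hpZ.not_isUnit (isUnit_of_dvd_one (by simpa using dvd_sub h h1))
  have hu1 : u - 1 ≠ 0 := sub_ne_zero.mpr hu
  have hfin : FiniteMultiplicity (p : ℤ) (u - 1) :=
    Int.finiteMultiplicity_iff.mpr ⟨by simpa using hp.ne_one, hu1⟩
  obtain ⟨c, hc, hs⟩ := hfin.exists_eq_pow_mul_and_not_dvd
  set s := multiplicity (p : ℤ) (u - 1)
  have hmul : ∀ j : ℕ, emultiplicity (p : ℤ) (u ^ j - 1) = s + emultiplicity p j := by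
    intro j
    have := Int.emultiplicity_pow_sub_pow hp hodd (x := u) (y := 1) h1 hpu j
    rw [one_pow] at this
    rw [this, emultiplicity_eq_coe.mpr]
    exact ⟨⟨c, hc⟩, fun ⟨e, he⟩ => hs ⟨e, mul_left_cancel₀ (pow_ne_zero s hpZ.ne_zero)
      (by rw [← hc, he, pow_succ, mul_assoc])⟩⟩
  have hdp : d ∣ p ^ (n - s) := by
    rw [← hd, pow_dvd_iff_le_emultiplicity, hmul]
    have : (↑(n - s) : ℕ∞) ≤ emultiplicity p (p ^ (n - s)) :=
      pow_dvd_iff_le_emultiplicity.mp dvd_rfl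
    calc (n : ℕ∞) ≤ ((s + (n - s) : ℕ) : ℕ∞) := by exact_mod_cast (by omega)
      _ = s + ((n - s : ℕ) : ℕ∞) := by push_cast; rfl
      _ ≤ _ := by gcongr
  obtain ⟨b, hb, rfl⟩ := (Nat.dvd_prime_pow hp).mp hdp
  set S : ℤ := ∑ i ∈ Finset.range (p ^ b), u ^ i with hS
  have hSu : S * (u - 1) = u ^ p ^ b - 1 := geom_sum_mul u (p ^ b)
  have hSb : ¬ (p : ℤ) ^ (b + 1) ∣ S := by
    intro h
    have h2 : (p : ℤ) ^ (b + 1 + s) ∣ u ^ p ^ b - 1 := by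
      rw [← hSu, pow_add]
      exact mul_dvd_mul h ⟨c, hc⟩
    rw [pow_dvd_iff_le_emultiplicity, hmul, emultiplicity_pow_self_of_prime hp.prime] at h2
    have : b + 1 + s ≤ s + b := by exact_mod_cast h2
    omega
  have hbm : (p : ℤ) ^ b ∣ m := by
    have h2 : (p : ℤ) ^ n ∣ m * (p : ℤ) ^ s := by
      have hcop : IsCoprime ((p : ℤ) ^ n) c := ((Prime.coprime_iff_not_dvd hpZ).mpr hs).pow_left
      rw [hc, ← mul_assoc] at hm
      exact hcop.dvd_of_dvd_mul_right hm
    rcases le_total n s with h | h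
    · have : b = 0 := by omega
      simp [this]
    · have h3 : (p : ℤ) ^ (n - s) ∣ m := by
        rw [← Nat.sub_add_cancel h, pow_add] at h2
        exact (mul_dvd_mul_iff_right (pow_ne_zero s hpZ.ne_zero)).mp (by simpa using h2)
      exact (pow_dvd_pow _ hb).trans h3
  have hg : ((Int.gcd S ((p : ℤ) ^ n) : ℕ) : ℤ) ∣ m := by
    have hgn : Int.gcd S ((p : ℤ) ^ n) ∣ p ^ n := by
      have := Int.gcd_dvd_right S ((p : ℤ) ^ n)
      exact_mod_cast this
    obtain ⟨a, -, ha⟩ := (Nat.dvd_prime_pow hp).mp hgn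
    have hgS := Int.gcd_dvd_left S ((p : ℤ) ^ n)
    rw [ha] at hgS ⊢
    push_cast at hgS ⊢
    refine (pow_dvd_pow _ ?_).trans hbm
    by_contra hab
    exact hSb ((pow_dvd_pow _ (by omega)).trans hgS)
  obtain ⟨e, he⟩ := hg
  refine ⟨-(e * Int.gcdA S ((p : ℤ) ^ n)), Int.gcdB S ((p : ℤ) ^ n) * e, ?_⟩
  have hbez := Int.gcd_eq_gcd_ab S ((p : ℤ) ^ n)
  rw [he, hbez]
  ring

/-- If conjugation by `y` is `k ↦ k ^ u` on `K`, then `(k y) ^ j = k ^ (1 + u + ⋯ + u ^ (j-1)) y ^ j`. -/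
lemma mul_pow_of_conj_eq_zpow {G : Type*} [Group G] {K : Subgroup G} {y : G} {u : ℤ}
    (hu : ∀ k ∈ K, y * k * y⁻¹ = k ^ u) {k : G} (hk : k ∈ K) (j : ℕ) :
    (k * y) ^ j = k ^ (∑ i ∈ Finset.range j, u ^ i) * y ^ j := by
  induction j with
  | zero => simp
  | succ j ih =>
    have h : y * k ^ (∑ i ∈ Finset.range j, u ^ i) =
        k ^ (u * ∑ i ∈ Finset.range j, u ^ i) * y := by
      rw [mul_inv_eq_iff_eq_mul.mp (hu _ (K.zpow_mem hk _)), ← zpow_mul, mul_comm u]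
    rw [pow_succ', ih, Finset.sum_range_succ', pow_succ' y, mul_assoc, ← mul_assoc y, h]
    simp only [pow_succ', ← Finset.mul_sum]
    rw [add_comm, pow_zero, zpow_add, zpow_one]
    group

/-- A cyclic normal `p`-subgroup `K` (`p` odd) containing its centralizer has a complement as soon
as the quotient is cyclic. -/
theorem exists_isComplement'_of_isCyclic {p n : ℕ} (hp : p.Prime) (hp2 : p ≠ 2) {G : Type*} [Group G]
    [Finite G] (K : Subgroup G) [K.Normal] [IsCyclic K] (hKcard : Nat.card K = p ^ n)
    (hcent : ∀ g : G, (∀ k ∈ K, g * k = k * g) → g ∈ K) (hcyc : IsCyclic (G ⧸ K)) :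
    ∃ H : Subgroup G, K.IsComplement' H := by
  obtain ⟨q, hq⟩ := hcyc.exists_generator
  obtain ⟨y, rfl⟩ := QuotientGroup.mk_surjective q
  obtain ⟨⟨x, hxK⟩, hx⟩ := IsCyclic.exists_generator (α := K)
  obtain ⟨u, hu⟩ := exists_conjNormal_eq_zpow K y
  have hu' : ∀ k ∈ K, y * k * y⁻¹ = k ^ u := fun k hk => by
    simpa using congrArg Subtype.val (hu ⟨k, hk⟩)
  have hxord : orderOf x = p ^ n := by
    rw [← hKcard, ← orderOf_eq_card_of_forall_mem_zpowers hx, Subgroup.orderOf_mk]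
  have hx' : ∀ k ∈ K, ∃ m : ℤ, x ^ m = k := fun k hk => by
    obtain ⟨m, hm⟩ := hx ⟨k, hk⟩
    exact ⟨m, congrArg Subtype.val hm⟩
  have hone : ∀ m : ℤ, x ^ m = 1 ↔ (p : ℤ) ^ n ∣ m := fun m => by
    rw [← orderOf_dvd_iff_zpow_eq_one, hxord]; push_cast; rfl
  have hpow : ∀ (j : ℕ) (k : G), k ∈ K → y ^ j * k * (y ^ j)⁻¹ = k ^ (u ^ j) := by
    intro j
    induction j with
    | zero => simp
    | succ j ih =>
      intro k hk
      have : y ^ (j + 1) * k * (y ^ (j + 1))⁻¹ = y ^ j * (y * k * y⁻¹) * (y ^ j)⁻¹ := by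
        rw [pow_succ]; group
      rw [this, hu' k hk, ih _ (K.zpow_mem hk _), ← zpow_mul, pow_succ']
  have hmemK : ∀ j : ℕ, y ^ j ∈ K ↔ (p : ℤ) ^ n ∣ u ^ j - 1 := by
    intro j
    rw [← hone, zpow_sub_one, mul_inv_eq_one, ← hpow j x hxK, mul_inv_eq_iff_eq_mul]
    constructor
    · intro h
      have hc := IsCyclic.isMulCommutative (α := K)
      exact congrArg Subtype.val (mul_comm' (⟨_, h⟩ : K) ⟨x, hxK⟩)
    · intro h
      refine hcent _ fun k hk => ?_
      obtain ⟨m, rfl⟩ := hx' k hk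
      exact (show Commute (y ^ j) x from h).zpow_right m
  have hmemd : ∀ j : ℕ, y ^ j ∈ K ↔ orderOf (y : G ⧸ K) ∣ j := by
    intro j
    rw [orderOf_dvd_iff_pow_eq_one, ← QuotientGroup.mk_pow, QuotientGroup.eq_one_iff]
  set d := orderOf (y : G ⧸ K) with hd
  obtain ⟨m, hm⟩ := hx' _ ((hmemd d).mpr dvd_rfl)
  have hmfix : (p : ℤ) ^ n ∣ m * (u - 1) := by
    rw [← hone, mul_sub, mul_one, zpow_sub, zpow_mul, mul_inv_eq_one, hm,
      ← hu' _ ((hmemd d).mpr dvd_rfl)]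
    group
  -- the `d`-th power of `x ^ t * y` is `x ^ (t * (1 + u + ⋯ + u ^ (d - 1)) + m)`
  obtain ⟨t, ht⟩ := exists_mul_geom_sum_add_dvd hp hp2
    (fun j => (hmemK j).symm.trans (hmemd j)) hmfix
  have hz : (x ^ t * y) ^ d = 1 := by
    rw [mul_pow_of_conj_eq_zpow hu' (K.zpow_mem hxK t), ← hm, ← zpow_mul, ← zpow_add, hone]
    exact ht
  have hmk : ((x ^ t * y : G) : G ⧸ K) = (y : G ⧸ K) := by
    rw [QuotientGroup.mk_mul, (QuotientGroup.eq_one_iff _).mpr (K.zpow_mem hxK t), one_mul]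
  have hdvd : ∀ j : ℤ, (x ^ t * y) ^ j ∈ K → (x ^ t * y) ^ j = 1 := by
    intro j hj
    rw [← QuotientGroup.eq_one_iff, QuotientGroup.mk_zpow, hmk, ← orderOf_dvd_iff_zpow_eq_one] at hj
    obtain ⟨i, hi⟩ := hj
    rw [hi, zpow_mul, zpow_natCast, hz, one_zpow]
  refine ⟨Subgroup.zpowers (x ^ t * y),
    Subgroup.isComplement'_of_card_mul_and_disjoint ?_ ?_⟩
  · have h1 : orderOf (x ^ t * y) = d := by
      refine Nat.dvd_antisymm (orderOf_dvd_of_pow_eq_one hz) ?_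
      rw [hd, ← hmk]
      exact orderOf_map_dvd (QuotientGroup.mk' K) _
    rw [Nat.card_zpowers, h1, hd, orderOf_eq_card_of_forall_mem_zpowers hq, mul_comm,
      ← Subgroup.card_eq_card_quotient_mul_card_subgroup]
  · rw [Subgroup.disjoint_def]
    rintro g hg ⟨j, rfl⟩
    exact hdvd j hg

/-- The quotient acts faithfully on `K` by conjugation, and the automorphism group of a cyclic group
of odd prime power order is cyclic. -/
lemma isCyclic_quotient_of_centralizer {p n : ℕ} (hp : p.Prime) (hp2 : p ≠ 2) {G : Type*} [Group G]
    (K : Subgroup G) [K.Normal] [IsCyclic K] (hKcard : Nat.card K = p ^ n)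
    (hcent : ∀ g : G, (∀ k ∈ K, g * k = k * g) → g ∈ K) (I : Subgroup G) :
    IsCyclic (I ⧸ K.subgroupOf I) := by
  have : Finite K := Nat.finite_of_card_ne_zero (by rw [hKcard]; exact pow_ne_zero _ hp.ne_zero)
  let f : I →* MulAut K := (MulAut.conjNormal (H := K)).comp I.subtype
  have hf : f.ker ≤ K.subgroupOf I := by
    intro g hg
    refine hcent g fun k hk => ?_
    have h := congrArg Subtype.val (DFunLike.congr_fun (MonoidHom.mem_ker.mp hg) ⟨k, hk⟩)
    rw [← mul_inv_eq_iff_eq_mul]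
    simpa [f] using h
  have : IsCyclic (ZMod (Nat.card K))ˣ := by
    rw [hKcard]; exact ZMod.isCyclic_units_of_prime_pow p hp hp2 n
  have : IsCyclic (MulAut K) := isCyclic_of_injective
    (IsCyclic.mulAutMulEquiv K).toMonoidHom (IsCyclic.mulAutMulEquiv K).injective
  have : IsCyclic (I ⧸ f.ker) :=
    isCyclic_of_injective (QuotientGroup.kerLift f) (QuotientGroup.kerLift_injective f)
  have hsurj : Function.Surjective (QuotientGroup.map f.ker (K.subgroupOf I) (MonoidHom.id I) hf) :=
    fun q => by
      obtain ⟨g, rfl⟩ := QuotientGroup.mk_surjective q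
      exact ⟨g, rfl⟩
  exact isCyclic_of_surjective _ hsurj

/-! ### Irreducible representations with an eigenvector of `K` -/

section Clifford

variable {E G V : Type*} [Field E] [Group G] [AddCommGroup V] [Module E V]
  {ρ : Representation E G V}

lemma Representation.IsIrreducible.eq_top_of_invariant (hρ : ρ.IsIrreducible) {M : Submodule E V}
    (hM : ∀ (g : G), ∀ v ∈ M, ρ g v ∈ M) {v : V} (hv : v ∈ M) (hv0 : v ≠ 0) : M = ⊤ := by
  let S : Subrepresentation ρ := ⟨M, fun g _ hv => hM g _ hv⟩
  rcases eq_bot_or_eq_top S with h | h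
  · have h' : M = ⊥ := congrArg Subrepresentation.toSubmodule h
    rw [h'] at hv
    exact absurd ((Submodule.mem_bot E).mp hv) hv0
  · exact congrArg Subrepresentation.toSubmodule h

lemma Representation.IsIrreducible.span_orbit_eq_top (hρ : ρ.IsIrreducible) {w : V} (hw : w ≠ 0) :
    Submodule.span E (Set.range fun g => ρ g w) = ⊤ := by
  refine hρ.eq_top_of_invariant (fun g v hv => ?_) (Submodule.subset_span ⟨1, rfl⟩) (by simpa)
  refine Submodule.span_induction (p := fun v _ => ρ g v ∈ Submodule.span E _) ?_ ?_ ?_ ?_ hv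
  · rintro _ ⟨h, rfl⟩
    exact Submodule.subset_span ⟨g * h, by simp⟩
  · simp
  · intro a b _ _ ha hb
    rw [map_add]
    exact add_mem ha hb
  · intro c a _ ha
    rw [map_smul]
    exact Submodule.smul_mem _ _ ha

variable {K : Subgroup G} [K.Normal] {l : K →* E} {w : V}

/-- The conjugate of an eigenvector of `K` by `g` is an eigenvector for the conjugate character. -/
lemma Representation.apply_conj_eigenvector (hlw : ∀ k : K, ρ k w = l k • w) (g : G) (k : K) :
    ρ k (ρ g w) = l (MulAut.conjNormal g⁻¹ k) • ρ g w := by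
  rw [← map_smul, ← hlw, ← Module.End.mul_apply, ← Module.End.mul_apply, ← map_mul, ← map_mul]
  congr 2
  simp [mul_assoc]

omit [K.Normal] in
lemma Representation.apply_mul_eigenvector (hlw : ∀ k : K, ρ k w = l k • w) {g h : G}
    (hgh : (g : G ⧸ K) = h) : ∃ c : E, ρ g w = c • ρ h w := by
  refine ⟨l ⟨h⁻¹ * g, QuotientGroup.eq.mp hgh.symm⟩, ?_⟩
  rw [← map_smul, ← hlw, ← Module.End.mul_apply, ← map_mul]
  simp

omit [K.Normal] in
lemma span_quotient_orbit_eq_top (hρ : ρ.IsIrreducible) (hw : w ≠ 0)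
    (hlw : ∀ k : K, ρ k w = l k • w) :
    Submodule.span E (Set.range fun q : G ⧸ K => ρ q.out w) = ⊤ := by
  rw [eq_top_iff, ← hρ.span_orbit_eq_top hw, Submodule.span_le]
  rintro _ ⟨g, rfl⟩
  obtain ⟨c, hc⟩ := Representation.apply_mul_eigenvector hlw (g := g) (h := (g : G ⧸ K).out)
    (by simp)
  simp only [SetLike.mem_coe, hc]
  exact Submodule.smul_mem _ _ (Submodule.subset_span ⟨_, rfl⟩)

/-- The kernel of the eigencharacter is normalized by `G`, as is every subgroup of a cyclic normal
subgroup, so it acts trivially on the span of the orbit of the eigenvector. -/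
lemma eigencharacter_injective [IsCyclic K] (hρ : ρ.IsIrreducible)
    (hρfaith : Function.Injective ρ) (hw : w ≠ 0) (hlw : ∀ k : K, ρ k w = l k • w) :
    Function.Injective l := by
  rw [injective_iff_map_eq_one]
  intro k hk
  have h1 : ρ (k : G) = 1 := by
    refine LinearMap.ext_on (hρ.span_orbit_eq_top hw) ?_
    rintro _ ⟨g, rfl⟩
    obtain ⟨u, hu⟩ := exists_conjNormal_eq_zpow K g⁻¹
    have h2 : l (k ^ u) = 1 := by
      have := map_zpow l.toHomUnits k u
      rw [show l.toHomUnits k = 1 from Units.ext hk, one_zpow] at this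
      exact congrArg Units.val this
    rw [Representation.apply_conj_eigenvector hlw, hu, h2, one_smul, Module.End.one_apply]
  exact Subtype.ext (hρfaith (by rw [h1]; simp))

/-- The conjugates of the eigenvector by elements of distinct cosets of `K` are eigenvectors of a
generator of `K` with distinct eigenvalues. -/
lemma linearIndependent_conj_eigenvector [IsCyclic K]
    (hcent : ∀ g : G, (∀ k ∈ K, g * k = k * g) → g ∈ K) (hl : Function.Injective l) (hw : w ≠ 0)
    (hlw : ∀ k : K, ρ k w = l k • w) {ι : Type*} (s : ι → G)
    (hs : Function.Injective fun i => (s i : G ⧸ K)) :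
    LinearIndependent E fun i => ρ (s i) w := by
  obtain ⟨x, hx⟩ := IsCyclic.exists_generator (α := K)
  refine Module.End.eigenvectors_linearIndependent' (ρ x)
    (fun i => l (MulAut.conjNormal (s i)⁻¹ x)) ?_ _ ?_
  · intro i j hij
    refine hs (QuotientGroup.eq.mpr (Subgroup.Normal.mem_comm ‹_› (hcent _ fun k hk => ?_)))
    obtain ⟨m, hm⟩ := hx ⟨k, hk⟩
    have h1 := congrArg (fun z => s j * ((z ^ m : K) : G) * (s i)⁻¹) (hl hij)
    simp only [← map_zpow, hm, MulAut.conjNormal_apply, inv_inv] at h1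
    simpa [mul_assoc] using h1
  · intro i
    refine ⟨Module.End.mem_eigenspace_iff.mpr (Representation.apply_conj_eigenvector hlw _ _), ?_⟩
    intro h0
    apply hw
    have := congrArg (ρ (s i)⁻¹) h0
    simpa using this

/-- The basis of an irreducible representation consisting of the conjugates of an eigenvector
of `K`, one for each coset of `K`. -/
noncomputable def conjEigenvectorBasis [IsCyclic K]
    (hcent : ∀ g : G, (∀ k ∈ K, g * k = k * g) → g ∈ K) (hl : Function.Injective l) (hw : w ≠ 0)
    (hlw : ∀ k : K, ρ k w = l k • w) (hρ : ρ.IsIrreducible) : Module.Basis (G ⧸ K) E V :=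
  Module.Basis.mk (linearIndependent_conj_eigenvector hcent hl hw hlw
    (fun q : G ⧸ K => q.out) (fun a b h => by simpa using h))
    (span_quotient_orbit_eq_top hρ hw hlw).ge

section Character

variable [Finite G] [IsCyclic K]

/-- An element outside `K` permutes the lines spanned by the conjugates of the eigenvector without
fixed lines. -/
lemma character_eq_zero_of_notMem (hcent : ∀ g : G, (∀ k ∈ K, g * k = k * g) → g ∈ K)
    (hl : Function.Injective l) (hw : w ≠ 0)
    (hlw : ∀ k : K, ρ k w = l k • w) (hρ : ρ.IsIrreducible) {g : G} (hg : g ∉ K) :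
    ρ.character g = 0 := by
  classical
  have := Fintype.ofFinite (G ⧸ K)
  let b := conjEigenvectorBasis hcent hl hw hlw hρ
  have hb : ∀ q, b q = ρ q.out w := fun q => by simp [b, conjEigenvectorBasis]
  rw [Representation.character, LinearMap.trace_eq_matrix_trace E b, Matrix.trace]
  refine Finset.sum_eq_zero fun q _ => ?_
  rw [Matrix.diag_apply, LinearMap.toMatrix_apply, hb, ← Module.End.mul_apply, ← map_mul]
  obtain ⟨c, hc⟩ := Representation.apply_mul_eigenvector hlw (g := g * q.out)
    (h := ((g : G ⧸ K) * q).out) (by simp)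
  rw [hc, ← hb, map_smul, Finsupp.smul_apply, Module.Basis.repr_self, Finsupp.single_apply,
    if_neg, smul_zero]
  intro h
  exact hg ((QuotientGroup.eq_one_iff g).mp (by simpa using h))

/-- The summand for `g` depends only on the coset of `g⁻¹`, and the conjugate of the eigenvector
belonging to this coset contributes it to the trace. -/
lemma card_mul_character_eq_sum [Fintype G]
    (hcent : ∀ g : G, (∀ k ∈ K, g * k = k * g) → g ∈ K)
    (hl : Function.Injective l) (hw : w ≠ 0)
    (hlw : ∀ k : K, ρ k w = l k • w) (hρ : ρ.IsIrreducible) (k : K) :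
    (Nat.card K : E) * ρ.character k = ∑ g : G, l (MulAut.conjNormal g k) := by
  classical
  have := Fintype.ofFinite (G ⧸ K)
  have := Fintype.ofFinite K
  let b := conjEigenvectorBasis hcent hl hw hlw hρ
  have hb : ∀ q, b q = ρ q.out w := fun q => by simp [b, conjEigenvectorBasis]
  have hcomm : ∀ k k' : K, MulAut.conjNormal (k' : G) k = k := fun k k' => by
    have hc := IsCyclic.isMulCommutative (α := K)
    apply Subtype.ext
    have := congrArg Subtype.val (mul_comm' k' k)
    rw [MulAut.conjNormal_apply, mul_inv_eq_iff_eq_mul]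
    exact this
  rw [Representation.character, LinearMap.trace_eq_matrix_trace E b, Matrix.trace,
    ← Equiv.sum_comp (Equiv.inv G),
    ← Equiv.sum_comp (Subgroup.groupEquivQuotientProdSubgroup (s := K)).symm,
    Fintype.sum_prod_type, Finset.mul_sum]
  refine Finset.sum_congr rfl fun q _ => ?_
  rw [Matrix.diag_apply, LinearMap.toMatrix_apply, hb,
    Representation.apply_conj_eigenvector hlw, ← hb, map_smul, Finsupp.smul_apply,
    Module.Basis.repr_self, Finsupp.single_eq_same, smul_eq_mul, mul_one]
  rw [Finset.sum_congr rfl (g := fun _ => l (MulAut.conjNormal q.out⁻¹ k)), Finset.sum_const,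
    Finset.card_univ, nsmul_eq_mul, Nat.card_eq_fintype_card]
  intro k' _
  obtain ⟨c, hc⟩ : ∃ c : K,
      (Subgroup.groupEquivQuotientProdSubgroup (s := K)).symm (q, k') = q.out * c := by
    refine ⟨⟨q.out⁻¹ * _, QuotientGroup.eq.mp ?_⟩, (mul_inv_cancel_left _ _).symm⟩
    have h := congrArg Prod.fst ((Subgroup.groupEquivQuotientProdSubgroup (s := K)).apply_symm_apply
      (q, k'))
    rw [QuotientGroup.out_eq']
    exact h.symm
  rw [Equiv.inv_apply, hc, mul_inv_rev, map_mul, MulAut.mul_apply, ← Subgroup.coe_inv, hcomm]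

end Character

/-- Frobenius reciprocity gives a surjection from the induced representation to `ρ`, and both have
dimension the index of `K`. -/
lemma nonempty_equiv_ind [Finite G] [IsCyclic K]
    (hcent : ∀ g : G, (∀ k ∈ K, g * k = k * g) → g ∈ K)
    (hl : Function.Injective l) (hρ : ρ.IsIrreducible) {W : Type*} [AddCommGroup W] [Module E W]
    (hW : Module.finrank E W = 1) (lam : Representation E K W) (hlam : ∀ k a, lam k a = l k • a)
    (f : Representation.IntertwiningMap lam (MonoidHom.comp ρ K.subtype))
    (hf : Function.Injective f) :
    Nonempty (Representation.Equiv ρ (Representation.ind K.subtype lam)) := by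
  have := Fintype.ofFinite (G ⧸ K)
  obtain ⟨w₀, hw₀, hspan⟩ := finrank_eq_one_iff'.mp hW
  have hfk : ∀ (k : K) a, ρ k (f a) = f (lam k a) := fun k a => by
    simpa using (Representation.IntertwiningMap.isIntertwining _ _ f k a).symm
  have hw : f w₀ ≠ 0 := fun h => hw₀ (hf (by rw [h, map_zero]))
  have hlw : ∀ k : K, ρ k (f w₀) = l k • f w₀ := fun k => by rw [hfk, hlam, map_smul]
  let Φ₀ : Representation.IndV K.subtype lam →ₗ[E] V := Representation.Coinvariants.lift _
    (TensorProduct.lift <| (Finsupp.lift _ _ _ fun h => ρ h⁻¹ ∘ₗ f.toLinearMap) ∘ₗ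
      (MonoidAlgebra.coeffLinearEquiv E).toLinearMap)
    fun k ↦ by
      ext h x
      simp only [LinearMap.coe_comp, Function.comp_apply, MonoidAlgebra.lsingle_apply]
      simp [Representation.ofMulAction_single, mul_inv_rev, ← hfk]
  have hΦ₀ : ∀ g a, Φ₀ (Representation.IndV.mk K.subtype lam g a) = ρ g⁻¹ (f a) := fun g a => by
    simp [Φ₀]
  let Φ : Representation.IntertwiningMap (Representation.ind K.subtype lam) ρ :=
    ⟨Φ₀, fun g => by ext h a; simp [Φ₀]⟩
  let b := conjEigenvectorBasis hcent hl hw hlw hρ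
  have hsurj : Function.Surjective Φ₀ := by
    refine LinearMap.range_eq_top.mp (top_le_iff.mp ?_)
    rw [← span_quotient_orbit_eq_top hρ hw hlw, Submodule.span_le]
    rintro _ ⟨q, rfl⟩
    exact ⟨Representation.IndV.mk K.subtype lam q.out⁻¹ w₀, by rw [hΦ₀, inv_inv]⟩
  -- the induced representation is spanned by one vector for each coset of `K`
  let T : (G ⧸ K → E) →ₗ[E] Representation.IndV K.subtype lam :=
    Fintype.linearCombination E fun q => Representation.IndV.mk K.subtype lam q.out⁻¹ w₀
  have hTq : ∀ q : G ⧸ K, Representation.IndV.mk K.subtype lam q.out⁻¹ w₀ ∈ LinearMap.range T :=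
    fun q => by
      classical
      exact ⟨Pi.single q 1, by simp [T]⟩
  have hTsurj : Function.Surjective T := by
    refine LinearMap.range_eq_top.mp ?_
    rw [← Submodule.ker_mkQ (LinearMap.range T), LinearMap.ker_eq_top]
    refine Representation.IndV.hom_ext _ _ fun g => LinearMap.ext fun a => ?_
    rw [LinearMap.zero_comp, LinearMap.zero_apply, LinearMap.comp_apply, Submodule.mkQ_apply,
      Submodule.Quotient.mk_eq_zero]
    obtain ⟨c, rfl⟩ := hspan a
    rw [map_smul]
    refine Submodule.smul_mem _ _ ?_
    let k : K := ⟨((g⁻¹ : G) : G ⧸ K).out⁻¹ * g⁻¹, QuotientGroup.eq.mp (by simp)⟩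
    have hk : Representation.IndV.mk K.subtype lam g w₀ =
        l k • Representation.IndV.mk K.subtype lam ((g⁻¹ : G) : G ⧸ K).out⁻¹ w₀ := by
      have h := Representation.Coinvariants.mk_self_apply
        (Representation.tprod ((Representation.leftRegular E G).comp K.subtype) lam) k
        (TensorProduct.tmul E (MonoidAlgebra.single g 1) w₀)
      have hkg : (k : G) * g = ((g⁻¹ : G) : G ⧸ K).out⁻¹ := by simp [k]
      rw [← map_smul, ← hlam]
      simpa [Representation.ofMulAction_single, hkg] using h.symm
    rw [hk]
    exact Submodule.smul_mem _ _ (hTq _)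
  have hcomp : Function.Injective (Φ₀ ∘ₗ T) := by
    have : FiniteDimensional E V := b.finiteDimensional_of_finite
    refine (LinearMap.injective_iff_surjective_of_finrank_eq_finrank ?_).mpr
      (hsurj.comp hTsurj)
    rw [Module.finrank_fintype_fun_eq_card, Module.finrank_eq_card_basis b]
  have hinj : Function.Injective Φ₀ := by
    intro x y hxy
    obtain ⟨x, rfl⟩ := hTsurj x
    obtain ⟨y, rfl⟩ := hTsurj y
    exact congrArg T (hcomp hxy)
  exact ⟨(Φ.ofBijective ⟨hinj, hsurj⟩).symm⟩

end Clifford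

/-! ### The character fields and the inertia group -/

section CharacterField

variable {F E : Type*} [Field F] [Field E] [Algebra F E]
  {G : Type*} [Group G] {K : Subgroup G} {l : K →* E}

variable (F l) in
/-- A multiplicative character as a homomorphism to the field generated by its values. -/
def charValHom : K →* charField F l where
  toFun := charVal F l
  map_one' := Subtype.ext (map_one l)
  map_mul' a b := Subtype.ext (map_mul l a b)

lemma charField_algHom_ext {B : Type*} [Semiring B] [Algebra F B] {σ τ : charField F l →ₐ[F] B}
    (h : ∀ k, σ (charVal F l k) = τ (charVal F l k)) : σ = τ :=
  IntermediateField.algHom_ext_of_eq_adjoin _ rfl (by rintro _ ⟨k, rfl⟩; exact h k)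

section Cyclotomic

variable [Finite K] [IsCyclic K]

omit [Finite K] in
lemma isPrimitiveRoot_of_injective (hl : Function.Injective l) :
    ∃ x : K, IsPrimitiveRoot (l x) (Nat.card K) := by
  obtain ⟨x, hx⟩ := IsCyclic.exists_generator (α := K)
  refine ⟨x, ?_⟩
  rw [← orderOf_eq_card_of_forall_mem_zpowers hx, ← orderOf_injective l hl x]
  exact IsPrimitiveRoot.orderOf _

lemma charField_eq_adjoin (hl : Function.Injective l) {ζ : E} (hζ : IsPrimitiveRoot ζ (Nat.card K)) :
    charField F l = IntermediateField.adjoin F {ζ} := by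
  have : NeZero (Nat.card K) := ⟨Nat.card_pos.ne'⟩
  apply le_antisymm
  · rw [charField, IntermediateField.adjoin_le_iff]
    rintro _ ⟨k, rfl⟩
    obtain ⟨i, -, hi⟩ := hζ.eq_pow_of_pow_eq_one (ξ := l k)
      (by rw [← map_pow, pow_card_eq_one', map_one])
    rw [← hi]
    exact pow_mem (IntermediateField.mem_adjoin_simple_self F ζ) i
  · rw [IntermediateField.adjoin_le_iff, Set.singleton_subset_iff]
    obtain ⟨x, hx⟩ := isPrimitiveRoot_of_injective hl
    obtain ⟨i, -, hi⟩ := hx.eq_pow_of_pow_eq_one hζ.pow_eq_one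
    rw [← hi, ← map_pow]
    exact (charVal F l (x ^ i)).2

variable [Algebra.IsIntegral F E]

variable (F) in
lemma isCyclotomicExtension_charField (hl : Function.Injective l) :
    IsCyclotomicExtension {Nat.card K} F (charField F l) := by
  have : NeZero (Nat.card K) := ⟨Nat.card_pos.ne'⟩
  obtain ⟨x, hx⟩ := isPrimitiveRoot_of_injective hl
  rw [charField_eq_adjoin hl hx]
  exact hx.intermediateField_adjoin_isCyclotomicExtension F

variable (F) in
lemma finiteDimensional_charField (hl : Function.Injective l) :
    FiniteDimensional F (charField F l) := by
  have : NeZero (Nat.card K) := ⟨Nat.card_pos.ne'⟩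
  have := isCyclotomicExtension_charField F hl
  exact IsCyclotomicExtension.finiteDimensional {Nat.card K} F _

variable (F) in
lemma isGalois_charField (hl : Function.Injective l) [CharZero F] :
    IsGalois F (charField F l) := by
  have : NeZero (Nat.card K) := ⟨Nat.card_pos.ne'⟩
  have := isCyclotomicExtension_charField F hl
  exact IsCyclotomicExtension.isGalois {Nat.card K} F _

end Cyclotomic

section Inertia

variable [K.Normal]

lemma ConjEqGalois.coe_apply {g : G} {τ : Gal(charField F l/F)} (h : ConjEqGalois F l g τ)
    (k : K) : (τ (charVal F l k) : E) = l (MulAut.conjNormal g k) :=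
  (congrArg Subtype.val (h k)).symm

lemma ConjEqGalois.eq {g : G} {σ τ : Gal(charField F l/F)} (hσ : ConjEqGalois F l g σ)
    (hτ : ConjEqGalois F l g τ) : σ = τ :=
  AlgEquiv.coe_toAlgHom_injective (charField_algHom_ext fun k => (hσ k).symm.trans (hτ k))

lemma ConjEqGalois.mul {g h : G} {σ τ : Gal(charField F l/F)} (hσ : ConjEqGalois F l g σ)
    (hτ : ConjEqGalois F l h τ) : ConjEqGalois F l (g * h) (σ * τ) := fun k => by
  rw [map_mul, MulAut.mul_apply, hσ, hτ, AlgEquiv.mul_apply]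

lemma conjEqGalois_one_of_mem [IsCyclic K] {k : G} (hk : k ∈ K) :
    ConjEqGalois F l k (1 : Gal(charField F l/F)) := fun k' => by
  have hc := IsCyclic.isMulCommutative (α := K)
  have : MulAut.conjNormal k k' = k' := by
    apply Subtype.ext
    rw [MulAut.conjNormal_apply, mul_inv_eq_iff_eq_mul]
    exact congrArg Subtype.val (mul_comm' (⟨k, hk⟩ : K) k')
  rw [this, AlgEquiv.one_apply]

lemma le_galoisInertia [IsCyclic K] : K ≤ galoisInertia F l :=
  fun _ hk => ⟨1, conjEqGalois_one_of_mem hk⟩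

variable (F l) in
/-- The homomorphism from the inertia group to `Gal(F(l)/F)` which sends `g` to the automorphism
with the same effect on `l` as conjugation by `g`. -/
noncomputable def inertiaHom : galoisInertia F l →* Gal(charField F l/F) where
  toFun g := g.2.choose
  map_one' := (Subtype.prop (1 : galoisInertia F l)).choose_spec.eq fun k => by simp
  map_mul' g h := (g * h).2.choose_spec.eq (g.2.choose_spec.mul h.2.choose_spec)

lemma conjEqGalois_inertiaHom (g : galoisInertia F l) :
    ConjEqGalois F l (g : G) (inertiaHom F l g) := g.2.choose_spec

lemma ker_inertiaHom [IsCyclic K] (hcent : ∀ g : G, (∀ k ∈ K, g * k = k * g) → g ∈ K)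
    (hl : Function.Injective l) :
    (inertiaHom F l).ker = K.subgroupOf (galoisInertia F l) := by
  ext g
  rw [MonoidHom.mem_ker, Subgroup.mem_subgroupOf]
  constructor
  · intro h
    refine hcent _ fun k hk => ?_
    have h1 := (conjEqGalois_inertiaHom g).coe_apply ⟨k, hk⟩
    rw [h] at h1
    have h2 := congrArg Subtype.val (hl h1)
    rw [MulAut.conjNormal_apply, eq_mul_inv_iff_mul_eq] at h2
    exact h2.symm
  · exact fun h => (conjEqGalois_inertiaHom g).eq (conjEqGalois_one_of_mem h)

variable [Fintype G] {χ : G → E}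

/-- The character of the representation induced from `l` has values in `F(l)`. -/
lemma charField_le_of_eq_sum [CharZero E] (h0 : ∀ g ∉ K, χ g = 0)
    (hsum : ∀ k : K, (Nat.card K : E) * χ k = ∑ g : G, l (MulAut.conjNormal g k)) :
    charField F χ ≤ charField F l := by
  rw [charField, IntermediateField.adjoin_le_iff]
  rintro _ ⟨g, rfl⟩
  by_cases hg : g ∈ K
  · have hK : (Nat.card K : E) ≠ 0 := Nat.cast_ne_zero.mpr Nat.card_pos.ne'
    rw [SetLike.mem_coe, eq_div_of_mul_eq hK ((mul_comm _ _).trans (hsum ⟨g, hg⟩))]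
    exact div_mem (sum_mem fun g _ => (charVal F l _).2) (natCast_mem _ _)
  · rw [h0 g hg]
    exact zero_mem _

/-- An automorphism of `F(l)` fixes the induced character exactly if it permutes the conjugates of
`l`. If it fixes the character, then two sums of characters of `K` are equal, hence by the linear
independence of characters they have the same constituents. -/
lemma range_inertiaHom [CharZero E] (h0 : ∀ g ∉ K, χ g = 0)
    (hsum : ∀ k : K, (Nat.card K : E) * χ k = ∑ g : G, l (MulAut.conjNormal g k))
    (hle : charField F χ ≤ charField F l) :
    (inertiaHom F l).range = (IntermediateField.restrict hle).fixingSubgroup := by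
  classical
  have hK : (Nat.card K : charField F l) ≠ 0 := Nat.cast_ne_zero.mpr Nat.card_pos.ne'
  let χ' : G → charField F l := fun g => ⟨χ g, hle (charVal F χ g).2⟩
  have hsum' : ∀ k : K, (Nat.card K : charField F l) * χ' k =
      ∑ g : G, charVal F l (MulAut.conjNormal g k) := fun k => Subtype.ext <| by
    rw [MulMemClass.coe_mul, AddSubmonoidClass.coe_finsetSum]
    exact hsum k
  ext τ
  rw [IntermediateField.mem_fixingSubgroup_iff]
  have hfix : (∀ x ∈ IntermediateField.restrict hle, τ x = x) ↔ ∀ k : K, τ (χ' k) = χ' k := by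
    refine ⟨fun h k => h _ ((IntermediateField.mem_restrict hle _).mpr (charVal F χ k).2), ?_⟩
    intro h x hx
    let M := IntermediateField.fixedField (Subgroup.zpowers τ)
    have hM : charField F χ ≤ IntermediateField.lift M := by
      rw [charField, IntermediateField.adjoin_le_iff]
      rintro _ ⟨g, rfl⟩
      refine (IntermediateField.mem_lift (χ' g)).mpr ?_
      rw [IntermediateField.mem_fixedField_iff]
      by_cases hg : g ∈ K
      · rintro _ ⟨i, rfl⟩
        have : τ ∈ MulAction.stabilizer Gal(charField F l/F) (χ' g) := h ⟨g, hg⟩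
        exact (MulAction.stabilizer Gal(charField F l/F) (χ' g)).zpow_mem this i
      · have : χ' g = 0 := Subtype.ext (h0 g hg)
        simp [this]
    have := (IntermediateField.mem_lift x).mp (hM ((IntermediateField.mem_restrict hle x).mp hx))
    exact (IntermediateField.mem_fixedField_iff _ x).mp this τ (Subgroup.mem_zpowers τ)
  rw [hfix]
  constructor
  · rintro ⟨g, rfl⟩ k
    refine mul_left_cancel₀ hK ?_
    conv_lhs => rw [← map_natCast (inertiaHom F l g) (Nat.card K), ← map_mul, hsum', map_sum]
    conv_rhs => rw [hsum', ← Equiv.sum_comp (Equiv.mulLeft (g : G))]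
    refine Finset.sum_congr rfl fun h _ => ?_
    rw [← conjEqGalois_inertiaHom g, Equiv.coe_mulLeft, map_mul, MulAut.mul_apply]
  · intro h
    let θ : G → K →* charField F l := fun g =>
      (charValHom F l).comp (MulAut.conjNormal g : MulAut K).toMonoidHom
    let θτ : G → K →* charField F l := fun g => (τ : charField F l →* charField F l).comp (θ g)
    have hli := linearIndependent_monoidHom K (charField F l)
    have heq : (∑ g, Finsupp.single (θτ g) (1 : charField F l)) = ∑ g, Finsupp.single (θ g) 1 := by
      apply hli
      ext1 k
      simp only [map_sum, Finsupp.linearCombination_single, one_smul, Finset.sum_apply]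
      have h1 : (Nat.card K : charField F l) * τ (χ' k) = Nat.card K * χ' k := by rw [h k]
      rw [hsum', ← map_natCast τ (Nat.card K), ← map_mul, hsum', map_sum] at h1
      exact h1
    have h2 := DFunLike.congr_fun heq (θτ 1)
    simp only [Finsupp.coe_finsetSum, Finset.sum_apply, Finsupp.single_apply, Finset.sum_boole]
      at h2
    have h3 : 0 < (Finset.univ.filter fun g => θτ g = θτ 1).card :=
      Finset.card_pos.mpr ⟨1, by simp⟩
    rw [Nat.cast_inj.mp h2, Finset.card_pos] at h3
    obtain ⟨g, hg⟩ := h3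
    have hgτ : ConjEqGalois F l g τ := fun k => by
      have := DFunLike.congr_fun (Finset.mem_filter.mp hg).2 k
      simpa [θ, θτ, charValHom] using this
    exact ⟨⟨g, τ, hgτ⟩, (conjEqGalois_inertiaHom _).eq hgτ⟩

end Inertia

end CharacterField

section ExtendScalars

variable {F E : Type*} [Field F] [Field E] [Algebra F E] {M L : IntermediateField F E}

/-- For intermediate fields `M ≤ L`, the automorphisms of `L` fixing `M` regarded as a subfield of
`L` are the `M`-automorphisms of `L`. -/
def fixingSubgroupRestrictEquiv (h : M ≤ L) :
    (IntermediateField.restrict h).fixingSubgroup ≃* Gal(IntermediateField.extendScalars h/M) where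
  toFun φ := { AlgEquiv.toRingEquiv (φ : Gal(L/F)) with
    commutes' := fun r => (IntermediateField.mem_fixingSubgroup_iff _ _).mp φ.2 ⟨r, h r.2⟩
      ((IntermediateField.mem_restrict h _).mpr r.2) }
  invFun φ := ⟨{ AlgEquiv.toRingEquiv φ with
      commutes' := fun r => φ.commutes (algebraMap F M r) },
    (IntermediateField.mem_fixingSubgroup_iff _ _).mpr fun x hx =>
      φ.commutes ⟨x, (IntermediateField.mem_restrict h x).mp hx⟩⟩
  left_inv _ := rfl
  right_inv _ := rfl
  map_mul' _ _ := rfl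

lemma isGalois_extendScalars (h : M ≤ L) [IsGalois F L] :
    IsGalois M (IntermediateField.extendScalars h) := by
  have : IsGalois F (IntermediateField.extendScalars h) := ‹IsGalois F L›
  exact IsGalois.tower_top_of_isGalois F M _

end ExtendScalars

/-! ### Simple quotients of semisimple rings -/

section SemisimpleQuotient

/-- The kernel of a homomorphism from a semisimple ring is generated by a central idempotent. The
kernel `J` is generated by an idempotent `g` as a left ideal, and the left ideal of all `x ∈ J` with
`g x = 0` is zero, being generated by an idempotent with square zero; hence `g` is a two-sided
identity of `J`, and so central. -/
lemma exists_central_idempotent_ker {R S : Type*} [Ring R] [IsSemisimpleRing R] [Ring S]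
    (f : R →+* S) :
    ∃ e ∈ Subring.center R, IsIdempotentElem e ∧ f e = 1 ∧ ∀ x, f x = 0 ↔ x * e = 0 := by
  obtain ⟨g, hg, hgJ⟩ := IsSemisimpleRing.ideal_eq_span_idempotent (RingHom.ker f)
  have hg0 : f g = 0 := by
    have : g ∈ RingHom.ker f := hgJ ▸ Ideal.mem_span_singleton_self g
    exact this
  have hxg : ∀ x, f x = 0 → x * g = x := fun x hx => by
    have : x ∈ Ideal.span {g} := hgJ ▸ (show x ∈ RingHom.ker f from hx)
    obtain ⟨a, rfl⟩ := Ideal.mem_span_singleton'.mp this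
    rw [mul_assoc, hg.eq]
  let N : Ideal R :=
    { carrier := {x | f x = 0 ∧ g * x = 0}
      add_mem' := fun {a b} ha hb => ⟨by rw [map_add, ha.1, hb.1, add_zero],
        by rw [mul_add, ha.2, hb.2, add_zero]⟩
      zero_mem' := ⟨map_zero f, mul_zero g⟩
      smul_mem' := fun r x hx => ⟨by rw [smul_eq_mul, map_mul, hx.1, mul_zero], by
        have h1 : g * r * g = g * r := hxg _ (by rw [map_mul, hg0, zero_mul])
        rw [smul_eq_mul, ← mul_assoc, ← h1, mul_assoc, hx.2, mul_zero]⟩ }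
  obtain ⟨h, hh, hhN⟩ := IsSemisimpleRing.ideal_eq_span_idempotent N
  have hmem : h ∈ N := hhN ▸ Ideal.mem_span_singleton_self h
  have hh0 : h = 0 := by
    rw [← hh.eq]
    nth_rw 1 [← hxg h hmem.1]
    rw [mul_assoc, hmem.2, mul_zero]
  have hN : N = ⊥ := by rw [hhN, hh0, Ideal.span_singleton_eq_bot]
  have hgx : ∀ x, f x = 0 → g * x = x := fun x hx => by
    have h1 : x - g * x ∈ N := ⟨by rw [map_sub, map_mul, hg0, hx, zero_mul, sub_zero],
      by rw [mul_sub, ← mul_assoc, hg.eq, sub_self]⟩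
    rw [hN, Ideal.mem_bot, sub_eq_zero] at h1
    exact h1.symm
  refine ⟨1 - g, Subring.mem_center_iff.mpr fun r => ?_, hg.one_sub, by simp [hg0], fun x => ?_⟩
  · have h1 := hxg (g * r) (by rw [map_mul, hg0, zero_mul])
    have h2 := hgx (r * g) (by rw [map_mul, hg0, mul_zero])
    rw [mul_sub, sub_mul, mul_one, one_mul, ← h1, mul_assoc, h2]
  · rw [mul_sub, mul_one, sub_eq_zero]
    exact ⟨fun hx => (hxg x hx).symm, fun hx => by rw [hx, map_mul, hg0, mul_zero]⟩

lemma eq_zero_or_one_of_isIdempotentElem_center {S : Type*} [Ring S] [IsSimpleRing S] {s : S}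
    (hs : IsIdempotentElem s) (hc : s ∈ Subring.center S) : s = 0 ∨ s = 1 := by
  let _ := (IsSimpleRing.isField_center S).toField
  have h : IsIdempotentElem (⟨s, hc⟩ : Subring.center S) := Subtype.ext hs.eq
  rcases IsIdempotentElem.iff_eq_zero_or_one.mp h with h | h
  · exact Or.inl (congrArg Subtype.val h)
  · exact Or.inr (congrArg Subtype.val h)

/-- A simple quotient `S` of a semisimple algebra `R` is the corner `e R e` for exactly one primitive
central idempotent `e` of `R`, the only one that is not in the kernel. -/
lemma exists_primitiveCentralIdempotent_corner {F R S : Type*} [Field F] [Ring R] [Algebra F R]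
    [IsSemisimpleRing R] [Ring S] [IsSimpleRing S] [Algebra F S] (f : R →ₐ[F] S)
    (hf : Function.Surjective f) :
    ∃ e : R, IsPrimitiveCentralIdempotent e ∧ f e ≠ 0 ∧
      (∀ e', IsPrimitiveCentralIdempotent e' → f e' ≠ 0 → e' = e) ∧
      ∀ he : IsIdempotentElem e, Nonempty (he.Corner ≃ₐ[F] S) := by
  obtain ⟨e, hec, hei, hfe, hker⟩ := exists_central_idempotent_ker f.toRingHom
  replace hfe : f e = 1 := hfe
  replace hker : ∀ x, f x = 0 ↔ x * e = 0 := hker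
  have hcomm : ∀ r, r * e = e * r := Subring.mem_center_iff.mp hec
  have h01 : ∀ c ∈ Subring.center R, IsIdempotentElem c → f c = 0 ∨ f c = 1 := by
    intro c hc hci
    refine eq_zero_or_one_of_isIdempotentElem_center (hci.map f)
      (Subring.mem_center_iff.mpr fun s => ?_)
    obtain ⟨r, rfl⟩ := hf s
    rw [← map_mul, ← map_mul, Subring.mem_center_iff.mp hc]
  have hone : ∀ c, f c = 1 → c * e = e := fun c hc => by
    have := (hker (1 - c)).mp (by rw [map_sub, map_one, hc, sub_self])
    rw [sub_mul, one_mul, sub_eq_zero] at this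
    exact this.symm
  refine ⟨e, ⟨hei, hec, ?_, ?_⟩, by rw [hfe]; exact one_ne_zero, ?_, fun he => ?_⟩
  · rintro rfl
    exact zero_ne_one ((map_zero f).symm.trans hfe)
  · intro c hc hci hce
    rcases h01 c hc hci with h | h
    · left
      rw [← hce, ← hcomm, (hker c).mp h]
    · right
      rw [← hce, ← hcomm, hone c h]
  · intro e' he' hne
    have h1 := hone e' ((h01 e' he'.central he'.idem).resolve_left hne)
    rcases he'.primitive e hec hei h1 with h | h
    · rw [h, map_zero] at hfe
      exact absurd hfe zero_ne_one
    · exact h.symm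
  · let φ : he.Corner →ₐ[F] S :=
      { toFun := fun x => f x.1
        map_one' := hfe
        map_mul' := fun a b => map_mul f a.1 b.1
        map_zero' := map_zero f
        map_add' := fun a b => map_add f a.1 b.1
        commutes' := fun a => by
          change f (a • e) = _
          rw [map_smul, hfe, Algebra.algebraMap_eq_smul_one] }
    refine ⟨AlgEquiv.ofBijective φ ⟨?_, ?_⟩⟩
    · rw [injective_iff_map_eq_zero]
      rintro ⟨x, hx⟩ h
      have hx' := (Subsemigroup.mem_corner_iff he).mp hx
      exact Subtype.ext (hx'.2.symm.trans ((hker x).mp h))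
    · intro s
      obtain ⟨r, rfl⟩ := hf s
      refine ⟨⟨e * r * e, ⟨r, rfl⟩⟩, ?_⟩
      change f (e * r * e) = f r
      rw [map_mul, map_mul, hfe, one_mul, mul_one]

end SemisimpleQuotient

/-! ### The action of `G` on the field of values -/

section CrossedProduct

/-- The universal property of a semidirect product, for monoid targets. -/
lemma Subgroup.IsComplement'.exists_monoidHom {G N : Type*} [Group G] [Monoid N] {K H : Subgroup G}
    [K.Normal] (hKH : K.IsComplement' H) (f₁ : K →* N) (f₂ : H →* N)
    (hf : ∀ (h : H) (k : K), f₂ h * f₁ k = f₁ (MulAut.conjNormal (h : G) k) * f₂ h) :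
    ∃ f : G →* N, (∀ k : K, f k = f₁ k) ∧ ∀ h : H, f h = f₂ h := by
  let e := SemidirectProduct.mulEquivSubgroup hKH
  let f' := SemidirectProduct.lift (φ := (K.normalizerMonoidHom).comp
      (Subgroup.inclusion (K.normalizer_eq_top ▸ le_top)))
    f₁.toHomUnits f₂.toHomUnits (fun h => by
      ext k
      simp only [MonoidHom.comp_apply, MulEquiv.coe_toMonoidHom, MulAut.conj_apply]
      rw [Units.val_mul, Units.eq_mul_inv_iff_mul_eq, Units.val_mul]
      exact (hf h k).symm)
  refine ⟨((Units.coeHom N).comp f').comp e.symm.toMonoidHom, fun k => ?_, fun h => ?_⟩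
  · have : e.symm k = SemidirectProduct.inl k := by
      rw [MulEquiv.symm_apply_eq]; simp [e]
    simp [this, f']
  · have : e.symm h = SemidirectProduct.inr h := by
      rw [MulEquiv.symm_apply_eq]; simp [e]
    simp [this, f']

/-- By Dedekind's independence of automorphisms and a dimension count, the endomorphisms of a
Galois extension `L` of `M` are the `L`-linear combinations of the automorphisms. -/
lemma subalgebra_end_eq_top {F L : Type*} [Field F] [Field L] [Algebra F L] [FiniteDimensional F L]
    [IsGalois F L] {M : IntermediateField F L} (A : Subalgebra F (Module.End M L)) {S : Set L}
    (hS : IntermediateField.adjoin F S = ⊤) (hmul : ∀ x ∈ S, Algebra.lmul M L x ∈ A)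
    (haut : ∀ τ : Gal(L/M), τ.toLinearMap ∈ A) : A = ⊤ := by
  have hμ : ∀ x, Algebra.lmul M L x ∈ A := by
    have h2 : Algebra.adjoin F S = ⊤ := by
      rw [← IntermediateField.adjoin_toSubalgebra, hS, IntermediateField.top_toSubalgebra]
    have h3 : A.comap ((Algebra.lmul M L).restrictScalars F) = ⊤ := by
      rw [← top_le_iff, ← h2, Algebra.adjoin_le_iff]
      exact hmul
    intro x
    have : x ∈ A.comap ((Algebra.lmul M L).restrictScalars F) := h3 ▸ Algebra.mem_top
    exact this
  have hspan : Submodule.span L (Set.range (AlgHom.toLinearMap : (L →ₐ[M] L) → L →ₗ[M] L)) = ⊤ := by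
    have := Fintype.ofFinite (L →ₐ[M] L)
    refine LinearIndependent.span_eq_top_of_card_eq_finrank' (linearIndependent_toLinearMap M L L) ?_
    rw [Module.finrank_linearMap_self, ← Nat.card_eq_fintype_card,
      Nat.card_congr (algEquivEquivAlgHom M L).toEquiv.symm]
    exact IsGalois.card_aut_eq_finrank M L
  refine top_le_iff.mp fun T _ => ?_
  have hT : T ∈ Submodule.span L (Set.range (AlgHom.toLinearMap : (L →ₐ[M] L) → L →ₗ[M] L)) :=
    hspan ▸ Submodule.mem_top
  induction hT using Submodule.span_induction with
  | zero => exact zero_mem _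
  | add x y _ _ hx hy => exact add_mem (hx trivial) (hy trivial)
  | smul a x _ hx => exact mul_mem (hμ a) (hx trivial)
  | mem x hx =>
    obtain ⟨τ, rfl⟩ := hx
    exact haut ((algEquivEquivAlgHom M L).symm τ)

lemma nonempty_end_algEquiv_matrix {F L : Type*} [Field F] [Field L] [Algebra F L]
    (M : IntermediateField F L) [FiniteDimensional M L] {d : ℕ} (hd : Module.finrank M L = d) :
    Nonempty (Module.End M L ≃ₐ[F] Matrix (Fin d) (Fin d) M) :=
  ⟨(algEquivMatrix (Module.finBasisOfFinrankEq M L hd)).restrictScalars F⟩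

variable {F E : Type*} [Field F] [Field E] [Algebra F E]
  {G : Type*} [Group G] {K H : Subgroup G} [K.Normal] {l : K →* E}

variable {s : G →* Gal(charField F l/F)} {M : IntermediateField F (charField F l)}

/-- The action of `G = K ⋊ H` on `F(l)` in which `K` acts by multiplication with the values of `l`
and `H` by field automorphisms. -/
lemma exists_action_charField (hs : ∀ g, ConjEqGalois F l g (s g))
    (hM : s.range = M.fixingSubgroup) (hKH : K.IsComplement' H) :
    ∃ π : G →* Module.End M (charField F l),
      (∀ (k : K) x, π k x = charVal F l k * x) ∧ ∀ (h : H) x, π h x = s h x := by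
  let f₁ : K →* Module.End M (charField F l) :=
    (Algebra.lmul M (charField F l) : charField F l →* _).comp (charValHom F l)
  let s' : G →* M.fixingSubgroup := s.codRestrict _ fun g => hM ▸ ⟨g, rfl⟩
  let f₂ : H →* Module.End M (charField F l) :=
    ((AlgEquiv.toLinearMapHom M (charField F l)).comp
      (IntermediateField.fixingSubgroupEquiv M).toMonoidHom).comp (s'.comp H.subtype)
  obtain ⟨π, h1, h2⟩ := hKH.exists_monoidHom f₁ f₂ (fun h k => by
    refine LinearMap.ext fun x => ?_
    change s h (charVal F l k * x) = charVal F l (MulAut.conjNormal (h : G) k) * s h x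
    rw [map_mul, hs])
  exact ⟨π, fun k x => by rw [h1]; rfl, fun h x => by rw [h2]; rfl⟩

omit [K.Normal] in
lemma Subgroup.IsComplement'.exists_mul_eq (hKH : K.IsComplement' H) (g : G) :
    ∃ (k : K) (h : H), (k : G) * h = g := by
  obtain ⟨⟨k, h⟩, hkh⟩ := hKH.2 g
  exact ⟨k, h, hkh⟩

omit [K.Normal] in
/-- The action of `G` generates all endomorphisms of `F(l)` over the field fixed by `G`. -/
lemma lift_action_surjective [FiniteDimensional F (charField F l)] [IsGalois F (charField F l)]
    (hs : ∀ k ∈ K, s k = 1)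
    (hM : s.range = M.fixingSubgroup) (hKH : K.IsComplement' H)
    {π : G →* Module.End M (charField F l)} (hπK : ∀ (k : K) x, π k x = charVal F l k * x)
    (hπH : ∀ (h : H) x, π h x = s h x) :
    Function.Surjective (MonoidAlgebra.lift F (Module.End M (charField F l)) G π) := by
  have hπ : ∀ g, π g ∈ (MonoidAlgebra.lift F (Module.End M (charField F l)) G π).range :=
    fun g => ⟨MonoidAlgebra.of F G g, MonoidAlgebra.lift_of π g⟩
  have hgen : IntermediateField.adjoin F (Set.range (charVal F l)) = ⊤ := by
    apply IntermediateField.lift_injective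
    rw [IntermediateField.lift_adjoin, IntermediateField.lift_top, ← Set.range_comp]
    rfl
  refine (AlgHom.range_eq_top _).mp (subalgebra_end_eq_top _ hgen ?_ fun τ => ?_)
  · rintro _ ⟨k, rfl⟩
    have : Algebra.lmul M (charField F l) (charVal F l k) = π k :=
      LinearMap.ext fun x => (hπK k x).symm
    exact this ▸ hπ k
  · have hmem : ((IntermediateField.fixingSubgroupEquiv M).symm τ : Gal(charField F l/F)) ∈
        s.range := by rw [hM]; exact Subtype.prop _
    obtain ⟨g, hg⟩ := hmem
    obtain ⟨k, h, rfl⟩ := hKH.exists_mul_eq g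
    rw [map_mul, hs k k.2, one_mul] at hg
    have : τ.toLinearMap = π h := LinearMap.ext fun x => by
      rw [hπH, hg]
      rfl
    exact this ▸ hπ h

variable {V : Type*} [AddCommGroup V] [Module E V] {ρ : Representation E G V} {w : V}

/-- The map `x ↦ ∑ h : H, (s h)⁻¹ x • ρ h w` embeds `F(l)`, with the action of `G = K ⋊ H`, into
`ρ`, and its image spans `ρ`. Hence the same elements of `F[G]` act as zero on both. -/
lemma lift_action_eq_zero_iff [Finite G] [IsCyclic K] (hs : ∀ g, ConjEqGalois F l g (s g))
    (hcent : ∀ g : G, (∀ k ∈ K, g * k = k * g) → g ∈ K)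
    (hl : Function.Injective l) (hw : w ≠ 0) (hlw : ∀ k : K, ρ k w = l k • w)
    (hρ : ρ.IsIrreducible) (hKH : K.IsComplement' H)
    {π : G →* Module.End M (charField F l)} (hπK : ∀ (k : K) x, π k x = charVal F l k * x)
    (hπH : ∀ (h : H) x, π h x = s h x) (x : MonoidAlgebra F G) :
    MonoidAlgebra.lift F (Module.End M (charField F l)) G π x = 0 ↔
      ρ.asAlgebraHom (MonoidAlgebra.mapRingHom G (algebraMap F E) x) = 0 := by
  classical
  have := Fintype.ofFinite H
  let J : charField F l →+ V :=
    { toFun := fun a => ∑ h : H, (((s h)⁻¹ a : charField F l) : E) • ρ h w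
      map_zero' := by simp
      map_add' := fun a b => by simp [add_smul, Finset.sum_add_distrib] }
  have hJ : ∀ a, J a = ∑ h : H, (((s h)⁻¹ a : charField F l) : E) • ρ h w := fun _ => rfl
  have hJsmul : ∀ (c : F) a, J (c • a) = algebraMap F E c • J a := fun c a => by
    simp [hJ, Finset.smul_sum, smul_smul, Algebra.smul_def]
  have hJK : ∀ (k : K) a, ρ k (J a) = J (charVal F l k * a) := fun k a => by
    rw [hJ, hJ, map_sum]
    refine Finset.sum_congr rfl fun h _ => ?_
    have h1 : (s h)⁻¹ (charVal F l k) = charVal F l (MulAut.conjNormal (h : G)⁻¹ k) := by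
      rw [← map_inv, ← hs]
    rw [map_smul, Representation.apply_conj_eigenvector hlw, smul_smul, map_mul, h1, mul_comm]
    rfl
  have hJH : ∀ (h : H) a, ρ h (J a) = J (s h a) := fun h a => by
    rw [hJ, hJ, map_sum, ← Equiv.sum_comp (Equiv.mulLeft h) fun h' : H =>
      (((s h')⁻¹ (s h a) : charField F l) : E) • ρ h' w]
    refine Finset.sum_congr rfl fun h' _ => ?_
    rw [map_smul, Equiv.coe_mulLeft, Subgroup.coe_mul, map_mul, map_mul, Module.End.mul_apply,
      mul_inv_rev, AlgEquiv.mul_apply, ← AlgEquiv.mul_apply (s h)⁻¹, inv_mul_cancel,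
      AlgEquiv.one_apply]
  have hJG : ∀ (g : G) a, ρ g (J a) = J (π g a) := fun g a => by
    obtain ⟨k, h, rfl⟩ := hKH.exists_mul_eq g
    rw [map_mul, Module.End.mul_apply, hJH, hJK, map_mul π, Module.End.mul_apply, hπK, hπH]
  have hJx : ∀ (x : MonoidAlgebra F G) a,
      ρ.asAlgebraHom (MonoidAlgebra.mapRingHom G (algebraMap F E) x) (J a) =
        J (MonoidAlgebra.lift F (Module.End M (charField F l)) G π x a) := by
    intro x a
    induction x using MonoidAlgebra.induction_linear with
    | zero => simp
    | add x y hx hy => simp [hx, hy]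
    | single g c =>
      rw [MonoidAlgebra.mapRingHom_single, Representation.asAlgebraHom_single,
        MonoidAlgebra.lift_single, LinearMap.smul_apply, LinearMap.smul_apply, hJsmul, hJG]
  have hinj : ∀ a, J a = 0 → a = 0 := by
    intro a ha
    have hli := linearIndependent_conj_eigenvector hcent hl hw hlw (fun h : H => (h : G))
      (fun h h' hh => by
        have h1 : (h : G)⁻¹ * h' ∈ K := QuotientGroup.eq.mp hh
        have h2 := Subgroup.disjoint_def.mp hKH.disjoint h1 (H.mul_mem (H.inv_mem h.2) h'.2)
        exact Subtype.ext (inv_mul_eq_one.mp h2))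
    have h1 := Fintype.linearIndependent_iff.mp hli _ ((hJ a).symm.trans ha) 1
    have h2 : (s ((1 : H) : G))⁻¹ a = 0 := Subtype.ext h1
    simpa using h2
  have hspan : Submodule.span E (Set.range J) = ⊤ := by
    refine hρ.eq_top_of_invariant (fun g v hv => ?_) (Submodule.subset_span ⟨1, rfl⟩)
      (fun h => one_ne_zero (hinj 1 h))
    rw [← Submodule.mem_comap]
    refine Submodule.span_le.mpr ?_ hv
    rintro _ ⟨a, rfl⟩
    exact Submodule.subset_span ⟨π g a, (hJG g a).symm⟩
  constructor
  · intro h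
    refine LinearMap.ext_on hspan ?_
    rintro _ ⟨a, rfl⟩
    rw [hJx, h, LinearMap.zero_apply, map_zero, LinearMap.zero_apply]
  · intro h
    refine LinearMap.ext fun a => hinj _ ?_
    rw [← hJx, h, LinearMap.zero_apply]

end CrossedProduct

/-! ### The character field and the Wedderburn component -/

section Split

variable {F E : Type*} [Field F] [Field E] [Algebra F E]
  {G : Type*} [Group G] [Fintype G] {K : Subgroup G} [K.Normal] {l : K →* E} {χ : G → E}
  {V : Type*} [AddCommGroup V] [Module E V] {ρ : Representation E G V} {w : V}

/-- If every element of `G` acts on `l` by a Galois automorphism, the image of `F[G]` under `ρ` is a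
full matrix algebra over the character field. -/
lemma exists_algHom_matrix [CharZero F] [CharZero E] [Algebra.IsIntegral F E] [IsCyclic K]
    (hcent : ∀ g : G, (∀ k ∈ K, g * k = k * g) → g ∈ K) (hl : Function.Injective l)
    (hw : w ≠ 0) (hlw : ∀ k : K, ρ k w = l k • w) (hρ : ρ.IsIrreducible)
    (h0 : ∀ g ∉ K, χ g = 0)
    (hsum : ∀ k : K, (Nat.card K : E) * χ k = ∑ g : G, l (MulAut.conjNormal g k))
    (hle : charField F χ ≤ charField F l) (hI : galoisInertia F l = ⊤) {H : Subgroup G}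
    (hKH : K.IsComplement' H) :
    ∃ f : MonoidAlgebra F G →ₐ[F]
        Matrix (Fin (Nat.card (G ⧸ K))) (Fin (Nat.card (G ⧸ K))) (charField F χ),
      Function.Surjective f ∧ ∀ x, f x = 0 ↔
        ρ.asAlgebraHom (MonoidAlgebra.mapRingHom G (algebraMap F E) x) = 0 := by
  have := finiteDimensional_charField F hl
  have := isGalois_charField F hl
  let ι : G →* galoisInertia F l := (MonoidHom.id G).codRestrict _ fun g => hI ▸ Subgroup.mem_top g
  let s : G →* Gal(charField F l/F) := (inertiaHom F l).comp ι
  have hs : ∀ g, ConjEqGalois F l g (s g) := fun g => conjEqGalois_inertiaHom (ι g)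
  have hsK : ∀ k ∈ K, s k = 1 := fun k hk => (hs k).eq (conjEqGalois_one_of_mem hk)
  let M := IntermediateField.restrict hle
  have hι : Function.Surjective ι := fun g => ⟨g, rfl⟩
  have hM : s.range = M.fixingSubgroup := by
    rw [← range_inertiaHom h0 hsum hle, MonoidHom.range_comp, MonoidHom.range_eq_top.mpr hι,
      MonoidHom.range_eq_map]
  have hker : s.ker = K := by
    ext g
    change inertiaHom F l (ι g) = 1 ↔ g ∈ K
    rw [← MonoidHom.mem_ker, ker_inertiaHom hcent hl]
    rfl
  have hcard : Module.finrank M (charField F l) = Nat.card (G ⧸ K) := by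
    rw [← IsGalois.card_aut_eq_finrank,
      Nat.card_congr (IntermediateField.fixingSubgroupEquiv M).symm.toEquiv, ← hM,
      Nat.card_congr (QuotientGroup.quotientKerEquivRange s).symm.toEquiv, hker]
  obtain ⟨π, hπK, hπH⟩ := exists_action_charField hs hM hKH
  obtain ⟨e₁⟩ := nonempty_end_algEquiv_matrix M hcard
  let e : _ ≃ₐ[F] Matrix (Fin (Nat.card (G ⧸ K))) (Fin (Nat.card (G ⧸ K))) (charField F χ) :=
    e₁.trans (IntermediateField.restrictAlgEquiv hle).symm.mapMatrix
  refine ⟨AlgHom.comp e.toAlgHom (MonoidAlgebra.lift F _ G π),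
    e.surjective.comp (lift_action_surjective hsK hM hKH hπK hπH), fun x => ?_⟩
  rw [← lift_action_eq_zero_iff hs hcent hl hw hlw hρ hKH hπK hπH, AlgHom.comp_apply]
  exact map_eq_zero_iff e e.injective

/-- If every element of `G` acts on `l` by a Galois automorphism and `y` generates `G` modulo `K`,
then the character field is the fixed field of the automorphism `σ` belonging to `y`. -/
lemma charField_eq_lift_fixedField [CharZero F] [CharZero E] [Algebra.IsIntegral F E] [IsCyclic K]
    (hl : Function.Injective l)
    (h0 : ∀ g ∉ K, χ g = 0)
    (hsum : ∀ k : K, (Nat.card K : E) * χ k = ∑ g : G, l (MulAut.conjNormal g k))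
    (hle : charField F χ ≤ charField F l) (hI : galoisInertia F l = ⊤) {y : G}
    (hy : Subgroup.zpowers (y : G ⧸ K) = ⊤) {σ : Gal(charField F l/F)}
    (hσ : ConjEqGalois F l y σ) :
    charField F χ =
      IntermediateField.lift (IntermediateField.fixedField (Subgroup.zpowers σ)) := by
  have := finiteDimensional_charField F hl
  have := isGalois_charField F hl
  have hrange : Subgroup.zpowers σ = (inertiaHom F l).range := by
    have hyI : y ∈ galoisInertia F l := hI ▸ Subgroup.mem_top y
    have hσy : inertiaHom F l ⟨y, hyI⟩ = σ := (conjEqGalois_inertiaHom _).eq hσ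
    apply le_antisymm
    · rw [Subgroup.zpowers_le]
      exact ⟨_, hσy⟩
    · rintro _ ⟨g, rfl⟩
      obtain ⟨j, hj⟩ : ((g : G) : G ⧸ K) ∈ Subgroup.zpowers (y : G ⧸ K) := hy ▸ Subgroup.mem_top _
      have hk : (y ^ j)⁻¹ * (g : G) ∈ K := QuotientGroup.eq.mp (by simpa using hj)
      refine ⟨j, ?_⟩
      have h1 : inertiaHom F l ((⟨y, hyI⟩ ^ j)⁻¹ * g) = 1 :=
        (conjEqGalois_inertiaHom _).eq (conjEqGalois_one_of_mem hk)
      rw [map_mul, map_inv, map_zpow, hσy, inv_mul_eq_one] at h1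
      exact h1
  rw [hrange, range_inertiaHom h0 hsum hle, IsGalois.fixedField_fixingSubgroup,
    IntermediateField.lift_restrict]

end Split

theorem theorem7p0p2 {p n : ℕ} (hp : p.Prime) (hp2 : p ≠ 2) (hn : 0 < n)
    {F : Type*} [Field F] [CharZero F]
    {Fbar : Type*} [Field Fbar] [Algebra F Fbar] [IsAlgClosure F Fbar]
    {G : Type*} [Group G] [Finite G]
    (K : Subgroup G) [K.Normal]
    (hKmax : Maximal (fun H : Subgroup G => H.Normal ∧ IsMulCommutative H) K)
    (hKcyc : IsCyclic K) (hKcard : Nat.card K = p ^ n) (hGK : commutator G ≤ K)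
    {V : Type*} [AddCommGroup V] [Module Fbar V] [FiniteDimensional Fbar V]
    (ρ : Representation Fbar G V) (hρirr : ρ.IsIrreducible) (hρfaith : Function.Injective ρ)
    {W : Type*} [AddCommGroup W] [Module Fbar W] [FiniteDimensional Fbar W]
    (lam : Representation Fbar K W) (hlam : lam.IsIrreducible)
    (hconst : ∃ f : Representation.IntertwiningMap lam (MonoidHom.comp ρ K.subtype),
      Function.Injective f) :
    -- part (1)
    (Module.finrank Fbar W = 1 ∧ Function.Injective lam ∧
      Nonempty (Representation.Equiv ρ (Representation.ind K.subtype lam)) ∧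
      (∀ ζ : Fbar, IsPrimitiveRoot ζ (p ^ n) →
        charField F lam.character = IntermediateField.adjoin F {ζ}) ∧
      K ≤ galoisInertia F lam.character ∧
      ∃ hle : charField F ρ.character ≤ charField F lam.character,
        IsGalois (charField F ρ.character) (IntermediateField.extendScalars hle) ∧
        Nonempty ((galoisInertia F lam.character ⧸
            K.subgroupOf (galoisInertia F lam.character)) ≃*
          Gal(IntermediateField.extendScalars hle/charField F ρ.character)) ∧
        IsCyclic (galoisInertia F lam.character ⧸
          K.subgroupOf (galoisInertia F lam.character))) ∧
    -- part (2)
    (galoisInertia F lam.character = ⊤ →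
      ∀ (y : G) (d : ℕ), Subgroup.zpowers (y : G ⧸ K) = ⊤ → Nat.card (G ⧸ K) = d →
        (∃ σ : Gal(charField F lam.character/F),
          ConjEqGalois F lam.character y σ ∧
          charField F ρ.character =
            IntermediateField.lift (IntermediateField.fixedField (Subgroup.zpowers σ))) ∧
        (∃! e : MonoidAlgebra F G, IsWedderburnIdempotent F ρ e) ∧
        ∀ (e : MonoidAlgebra F G) (he : IsWedderburnIdempotent F ρ e),
          Nonempty (he.idem.Corner ≃ₐ[F]
            Matrix (Fin d) (Fin d) (charField F ρ.character))) := by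
  have := Fintype.ofFinite G
  have : Algebra.IsAlgebraic F Fbar := IsAlgClosure.isAlgebraic
  have : IsAlgClosed Fbar := IsAlgClosure.isAlgClosed F
  have : CharZero Fbar := charZero_of_injective_algebraMap (algebraMap F Fbar).injective
  have := hKmax.prop.2
  have hcent : ∀ g : G, (∀ k ∈ K, g * k = k * g) → g ∈ K :=
    fun g => mem_of_commute_of_maximal hKmax hGK
  have hW : Module.finrank Fbar W = 1 :=
    Representation.IsIrreducible.finrank_eq_one_of_isMulCommutative lam
  obtain ⟨w₀, hw₀, hspan⟩ := finrank_eq_one_iff'.mp hW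
  -- `lam` acts through scalars, which form its character
  obtain ⟨l, hlam⟩ : ∃ l : K →* Fbar, ∀ k a, lam k a = l k • a := by
    choose c hc using fun k => hspan (lam k w₀)
    have hinj : ∀ a b : Fbar, a • w₀ = b • w₀ → a = b := fun a b h => smul_left_injective _ hw₀ h
    refine ⟨⟨⟨c, hinj _ _ (by simp [hc])⟩, fun a b => hinj _ _ ?_⟩, fun k a => ?_⟩
    · simp only
      rw [hc, map_mul, Module.End.mul_apply, ← hc b, map_smul, ← hc a, smul_smul, mul_comm]
    · obtain ⟨b, rfl⟩ := hspan a
      rw [map_smul, ← hc k, smul_comm]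
      rfl
  have hchar : lam.character = l := funext fun k => by
    have : lam k = l k • LinearMap.id := LinearMap.ext fun a => hlam k a
    rw [Representation.character, this, map_smul, LinearMap.trace_id, hW, Nat.cast_one,
      smul_eq_mul, mul_one]
  obtain ⟨f, hf⟩ := hconst
  have hfk : ∀ (k : K) a, ρ k (f a) = f (lam k a) := fun k a => by
    simpa using (Representation.IntertwiningMap.isIntertwining _ _ f k a).symm
  have hw : f w₀ ≠ 0 := fun h => hw₀ (hf (by rw [h, map_zero]))
  have hlw : ∀ k : K, ρ k (f w₀) = l k • f w₀ := fun k => by rw [hfk, hlam, map_smul]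
  have hl : Function.Injective l := eigencharacter_injective hρirr hρfaith hw hlw
  have h0 : ∀ g ∉ K, ρ.character g = 0 :=
    fun g hg => character_eq_zero_of_notMem hcent hl hw hlw hρirr hg
  have hsum := card_mul_character_eq_sum hcent hl hw hlw hρirr
  have hle : charField F ρ.character ≤ charField F l := charField_le_of_eq_sum h0 hsum
  have := isGalois_charField F hl
  rw [hchar]
  refine ⟨⟨hW, ?_, nonempty_equiv_ind hcent hl hρirr hW lam hlam f hf, ?_, le_galoisInertia, hle,
    isGalois_extendScalars hle, ?_, ?_⟩, ?_⟩
  · intro a b hab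
    refine hl (smul_left_injective _ hw₀ ?_)
    change l a • w₀ = l b • w₀
    rw [← hlam, ← hlam, hab]
  · intro ζ hζ
    exact charField_eq_adjoin hl (hKcard ▸ hζ)
  · exact ⟨(QuotientGroup.quotientMulEquivOfEq (ker_inertiaHom hcent hl).symm).trans
      ((QuotientGroup.quotientKerEquivRange (inertiaHom F l)).trans
      ((MulEquiv.subgroupCongr (range_inertiaHom h0 hsum hle)).trans
      (fixingSubgroupRestrictEquiv hle)))⟩
  · exact isCyclic_quotient_of_centralizer hp hp2 K hKcard hcent _
  · rintro hI y d hy rfl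
    have hyI : y ∈ galoisInertia F l := hI ▸ Subgroup.mem_top y
    have hcyc : IsCyclic (G ⧸ K) := ⟨(y : G ⧸ K), fun q =>
      Subgroup.mem_zpowers_iff.mp (by rw [hy]; exact Subgroup.mem_top q)⟩
    obtain ⟨H, hKH⟩ := exists_isComplement'_of_isCyclic hp hp2 K hKcard hcent hcyc
    obtain ⟨φ, hφ, hφ0⟩ :=
      exists_algHom_matrix hcent hl hw hlw hρirr h0 hsum hle hI hKH
    have : NeZero (Nat.card G : F) := ⟨Nat.cast_ne_zero.mpr Nat.card_pos.ne'⟩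
    have : Nonempty (Fin (Nat.card (G ⧸ K))) := ⟨⟨0, Nat.card_pos⟩⟩
    obtain ⟨e, he, hne, huniq, hcorner⟩ := exists_primitiveCentralIdempotent_corner φ hφ
    have hW' : ∀ e', IsWedderburnIdempotent F ρ e' → e' = e := fun e' he' =>
      huniq e' he'.toIsPrimitiveCentralIdempotent (fun h => he'.map_ne_zero ((hφ0 e').mp h))
    refine ⟨?_, ⟨e, ⟨he, fun h => hne ((hφ0 e).mpr h)⟩, hW'⟩, ?_⟩
    · obtain ⟨σ, hσ⟩ := hyI
      exact ⟨σ, hσ, charField_eq_lift_fixedField hl h0 hsum hle hI hy hσ⟩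
    · intro e' he'
      obtain rfl := hW' e' he'
      exact hcorner he'.idem
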